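/- Let $m\ge 1$, $q\ge 0$, $\alpha\in(0,1)$, and let $Y_1,\dots,Y_m$ be random vectors in $\mathbb{R}^q$ with finite second moments and positive definite variance-covariance matrices. For each $p\in\{1,\dots,m\}$ let $Y_{p1},Y_{p2},\dots$ be i.i.d. samples of $Y_p$, all the $Y_{pj}$ being mutually independent, also across $p$. From source $p$ the first $n_p$ samples are observed; put $n=\frac1m\sum_{p=1}^m n_p$, and suppose that $n\to\infty$ along a sequence of sample-size vectors $(n_1,\dots,n_m)$ for which $n_p/n\to\beta_p>0$ for every $p$. Let $\chi^2_{q,1-\alpha}$ be the $(1-\alpha)$-quantile of the $\chi^2$ distribution with $q$ degrees of freedom, let $\Delta_s=\{v\in\mathbb{R}^s: v\ge 0,\ \sum_j v_j=1\}$, and define (with $\log 0=-\infty$) $$\mathcal{U}_\alpha=\Big\{w=(w_p)_{p}:\ w_p\in\Delta_{n_p}\ (1\le p\le m),\ -2\sum_{p=1}^m\sum_{j=1}^{n_p}\log(n_p w_{pj})\le \chi^2_{q,1-\alpha}\Big\},$$ $$C_\alpha=\Big\{\sum_{p=1}^m\sum_{j=1}^{n_p} Y_{pj}\,w_{pj}:\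 w\in\mathcal{U}_\alpha\Big\},\qquad B_\ell=\max_{c\in C_\alpha} c_\ell\quad(1\le \ell\le q),$$ and $\bar\mu=\sum_{p=1}^m \mathrm{E}[Y_p]$. Then the maxima defining $B=(B_1,\dots,B_q)$ are attained whenever all $n_p\ge 1$, and $$\liminf_{n\to\infty}\Pr\{\bar\mu_\ell\le B_\ell\ \text{for all } \ell\in\{1,\dots,q\}\}\ \ge\ 1-\alpha .$$ -/

import Mathlib

open MeasureTheory ProbabilityTheory Filter
open scoped Topology

namespace EmpLik

/-- The `χ²` distribution with `q` degrees of freedom: the law of the sum of the squares of `q`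
independent standard normal random variables. -/
noncomputable def chiSqLaw (q : ℕ) : Measure ℝ :=
  (Measure.pi fun _ : Fin q => gaussianReal 0 1).map fun x => ∑ i, x i ^ 2

/-- The `u`-quantile `χ²_{q,u}` of the `χ²` distribution with `q` degrees of freedom. -/
noncomputable def chiSqQuantile (q : ℕ) (u : ℝ) : ℝ :=
  sInf {x : ℝ | u ≤ (chiSqLaw q).real (Set.Iic x)}

/-- The variance-covariance matrix of a random vector. -/
noncomputable def covarianceMatrix {Ω : Type*} [MeasurableSpace Ω] {q : ℕ}
    (P : Measure Ω) (Y : Ω → EuclideanSpace ℝ (Fin q)) : Matrix (Fin q) (Fin q) ℝ :=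
  Matrix.of fun i j => covariance (fun ω => Y ω i) (fun ω => Y ω j) P

/-- The average `n = (1/m) ∑ p, n_p` of the sample sizes. -/
noncomputable def avgSize {m : ℕ} (N : Fin m → ℕ) : ℝ :=
  (1 / (m : ℝ)) * ∑ p, (N p : ℝ)

/-- The ambiguity set `U_α`: families of probability weights `w_p` on the `n_p` observations of
source `p` with `-2 ∑ p, ∑ j, log (n_p w_pj) ≤ χ²_{q,1-α}`.
Since `log 0 = -∞` in this inequality, it forces all weights to be positive; this is spelled out
because `Real.log 0 = 0`. -/
def ambiguitySet {m : ℕ} (q : ℕ) (α : ℝ) (N : Fin m → ℕ) : Set ((p : Fin m) → Fin (N p) → ℝ) :=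
  {w | (∀ p, w p ∈ stdSimplex ℝ (Fin (N p))) ∧ (∀ p j, 0 < w p j) ∧
    -2 * ∑ p, ∑ j, Real.log ((N p : ℝ) * w p j) ≤ chiSqQuantile q (1 - α)}

/-- The confidence region `C_α` of the data `y`: all sums over the sources of the weighted means,
with weights in `U_α`. -/
def confidenceRegion {m q : ℕ} (α : ℝ) (N : Fin m → ℕ)
    (y : (p : Fin m) → Fin (N p) → EuclideanSpace ℝ (Fin q)) : Set (EuclideanSpace ℝ (Fin q)) :=
  (fun w : (p : Fin m) → Fin (N p) → ℝ => ∑ p, ∑ j, w p j • y p j) '' ambiguitySet q α N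

/-- The bound `B_ℓ`, the largest `ℓ`-th coordinate of a point of `C_α`. -/
noncomputable def coordBound {m q : ℕ} (α : ℝ) (N : Fin m → ℕ)
    (y : (p : Fin m) → Fin (N p) → EuclideanSpace ℝ (Fin q)) (l : Fin q) : ℝ :=
  sSup ((fun c : EuclideanSpace ℝ (Fin q) => c l) '' confidenceRegion α N y)

end EmpLik

/-! Only a lower bound on each `B_l` is needed, so one good weight vector per coordinate suffices.
Perturb the uniform weights linearly in the centred `l`-th coordinate, with strength `c = b√n`. By
Taylor expansion of the logarithm the likelihood cost tends to `b² V_ll` and the gain over the sum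
of sample means is about `b V_ll / √n`, where `V = ∑ p, (β p)⁻¹ Cov(Y p)`. Writing `r` for the `χ²`
quantile, any gain `θ / √n` with `0 ≤ θ < √(r V_ll)` is therefore reached eventually, almost surely
(`sum_sampleMean_add_le_coordBound`, `eventually_lt_coordBound`).

By the central limit theorem (`le_liminf_measure_scaledDeviation_mem`) the coverage is then
asymptotically at least the `N(0, V)` mass of the orthant `-x_l < s √V_ll` for every `s < √r`, hence
for `s = √r`. Up to a null set this orthant contains the ellipsoid `V^{1/2}{‖z‖² ≤ r}`, by
Cauchy–Schwarz, and the ellipsoid has at least the `χ²` mass of `(-∞, r]`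
(`chiSqLaw_Iic_le_multivariateGaussian`). -/

namespace EmpLik

/-! ### Quantiles of the `χ²` law, and a Taylor bound for the logarithm. -/

instance isProbabilityMeasure_chiSqLaw (q : ℕ) : IsProbabilityMeasure (chiSqLaw q) :=
  Measure.isProbabilityMeasure_map (Measurable.aemeasurable (by fun_prop))

lemma chiSqQuantile_nonneg (q : ℕ) {u : ℝ} (hu : 0 < u) : 0 ≤ chiSqQuantile q u := by
  refine Real.sInf_nonneg fun x hx => ?_
  by_contra! h
  have h0 : (chiSqLaw q).real (Set.Iic x) = 0 := by
    rw [chiSqLaw, map_measureReal_apply (by fun_prop) measurableSet_Iic]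
    have : (fun x : Fin q → ℝ => ∑ i, x i ^ 2) ⁻¹' Set.Iic x = ∅ := by
      ext z
      have : 0 ≤ ∑ i, z i ^ 2 := Finset.sum_nonneg fun _ _ => sq_nonneg _
      simp only [Set.mem_preimage, Set.mem_Iic, Set.mem_empty_iff_false, iff_false, not_le]
      linarith
    simp [this]
  simp only [Set.mem_ofPred_eq, h0] at hx
  linarith

/-- The quantile has at least the mass it should have below it, by right continuity. -/
lemma le_chiSqLaw_Iic_chiSqQuantile (q : ℕ) {u : ℝ} (hu1 : u < 1) :
    u ≤ (chiSqLaw q).real (Set.Iic (chiSqQuantile q u)) := by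
  have hcdf : ∀ x, (chiSqLaw q).real (Set.Iic x) = cdf (chiSqLaw q) x := fun x => by
    rw [cdf_eq_real]
  have hne : ({x : ℝ | u ≤ (chiSqLaw q).real (Set.Iic x)}).Nonempty := by
    have := (tendsto_cdf_atTop (chiSqLaw q)).eventually (eventually_ge_nhds hu1)
    obtain ⟨x, hx⟩ := this.exists
    exact ⟨x, by simpa [hcdf] using hx⟩
  rw [hcdf]
  have hcont := (cdf (chiSqLaw q)).right_continuous (chiSqQuantile q u)
  have htend := hcont.tendsto.mono_left
    (nhdsWithin_mono _ (Set.Ioi_subset_Ici_self))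
  refine ge_of_tendsto htend ?_
  filter_upwards [self_mem_nhdsWithin] with y hy
  obtain ⟨x, hx, hxy⟩ := exists_lt_of_csInf_lt hne hy
  have hx' : u ≤ cdf (chiSqLaw q) x := by simpa [hcdf] using hx
  exact hx'.trans (monotone_cdf _ hxy.le)

/-- The cubic Taylor remainder `|x|³ / (1 - |x|)` is at most `2δx²` because `1 - |x| ≥ 1/2`;
doubling it gives the `4δ`. -/
lemma neg_two_mul_log_one_add_le {x δ : ℝ} (hδ : δ ≤ 1 / 2) (hx : |x| ≤ δ) :
    -2 * Real.log (1 + x) ≤ -2 * x + (1 + 4 * δ) * x ^ 2 := by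
  have h := Real.abs_log_sub_add_sum_range_le (x := -x) (by rw [abs_neg]; linarith) 2
  simp only [Finset.sum_range_succ, Finset.sum_range_zero, abs_neg, sub_neg_eq_add] at h
  norm_num at h
  have h1 : |x| ^ 3 / (1 - |x|) ≤ 2 * (δ * x ^ 2) := by
    rw [div_le_iff₀ (by linarith)]
    have : |x| ^ 3 = |x| * x ^ 2 := by rw [pow_succ, sq_abs]; ring
    rw [this]
    have h2 : |x| * x ^ 2 ≤ δ * x ^ 2 := by gcongr
    have h3 : 0 ≤ δ * x ^ 2 := mul_nonneg ((abs_nonneg x).trans hx) (sq_nonneg x)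
    nlinarith
  have := (abs_le.1 (h.trans h1)).1
  linarith

/-! ### Attainment of the maxima. -/

section Compactness

variable {m q : ℕ} {α : ℝ} {N : Fin m → ℕ}

/-- Exponentiating turns the likelihood constraint into a closed condition on a product. Positivity
of the weights, an open condition, is then automatic: a zero weight would make the product vanish.
-/
lemma ambiguitySet_eq (hN : ∀ p, 0 < N p) : ambiguitySet q α N =
    (Set.univ.pi fun p => stdSimplex ℝ (Fin (N p))) ∩
      {w | Real.exp (-(chiSqQuantile q (1 - α) / 2)) ≤ ∏ p, ∏ j, (N p : ℝ) * w p j} := by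
  have hN' : ∀ p, (0 : ℝ) < N p := fun p => by exact_mod_cast hN p
  have key : ∀ w : (p : Fin m) → Fin (N p) → ℝ, (∀ p j, 0 < w p j) →
      (-2 * ∑ p, ∑ j, Real.log ((N p : ℝ) * w p j) ≤ chiSqQuantile q (1 - α) ↔
      Real.exp (-(chiSqQuantile q (1 - α) / 2)) ≤ ∏ p, ∏ j, (N p : ℝ) * w p j) := by
    intro w hw
    have hpos : ∀ p j, 0 < (N p : ℝ) * w p j := fun p j => mul_pos (hN' p) (hw p j)
    rw [← Real.le_log_iff_exp_le (Finset.prod_pos fun p _ => Finset.prod_pos fun j _ => hpos p j),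
      Real.log_prod (fun p _ => (Finset.prod_pos fun j _ => hpos p j).ne')]
    simp_rw [fun p => Real.log_prod (s := Finset.univ) (fun j _ => (hpos p j).ne')]
    constructor <;> intro h <;> linarith
  ext w
  simp only [ambiguitySet, Set.mem_ofPred_eq, Set.mem_inter_iff, Set.mem_univ_pi]
  constructor
  · rintro ⟨h1, h2, h3⟩
    exact ⟨h1, (key w h2).1 h3⟩
  · rintro ⟨h1, h3⟩
    have h2 : ∀ p j, 0 < w p j := by
      intro p j
      refine lt_of_le_of_ne ((h1 p).1 j) fun h0 => ?_
      have : ∏ p, ∏ j, (N p : ℝ) * w p j = 0 :=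
        Finset.prod_eq_zero (Finset.mem_univ p)
          (Finset.prod_eq_zero (Finset.mem_univ j) (by simp [← h0]))
      rw [this] at h3
      exact absurd h3 (not_le.2 (Real.exp_pos _))
    exact ⟨h1, h2, (key w h2).2 h3⟩

lemma isCompact_ambiguitySet (hN : ∀ p, 0 < N p) : IsCompact (ambiguitySet q α N) := by
  rw [ambiguitySet_eq hN]
  exact (isCompact_univ_pi fun p => isCompact_stdSimplex ℝ (Fin (N p))).inter_right
    (isClosed_le (by fun_prop) (by fun_prop))

lemma ambiguitySet_nonempty (hα : α < 1) (hN : ∀ p, 0 < N p) :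
    (ambiguitySet q α N).Nonempty := by
  have hN' : ∀ p, (0 : ℝ) < N p := fun p => by exact_mod_cast hN p
  refine ⟨fun p _ => (N p : ℝ)⁻¹, fun p => ⟨fun _ => by simp, ?_⟩,
    fun p _ => inv_pos.2 (hN' p), ?_⟩
  · simp [(hN' p).ne']
  · have : ∀ p, Real.log ((N p : ℝ) * (N p : ℝ)⁻¹) = 0 := fun p => by
      rw [mul_inv_cancel₀ (hN' p).ne', Real.log_one]
    simpa [this] using chiSqQuantile_nonneg q (sub_pos.2 hα)

lemma isGreatest_coordBound (hα : α < 1) (hN : ∀ p, 0 < N p)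
    (y : (p : Fin m) → Fin (N p) → EuclideanSpace ℝ (Fin q)) (l : Fin q) :
    IsGreatest ((fun c : EuclideanSpace ℝ (Fin q) => c l) '' confidenceRegion α N y)
      (coordBound α N y l) := by
  refine IsCompact.isGreatest_sSup ?_ ?_
  · refine IsCompact.image (IsCompact.image (isCompact_ambiguitySet hN) ?_) ?_ <;> fun_prop
  · exact ((ambiguitySet_nonempty hα hN).image _).image _

end Compactness

/-! ### Sample moments and tilted weights. -/

/-- The mean of the first `n` terms of a sequence. -/
noncomputable def sampleMean (x : ℕ → ℝ) (n : ℕ) : ℝ :=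
  (∑ i ∈ Finset.range n, x i) / n

/-- The (biased) variance of the first `n` terms of a sequence. -/
noncomputable def sampleVar (x : ℕ → ℝ) (n : ℕ) : ℝ :=
  (∑ i ∈ Finset.range n, (x i - sampleMean x n) ^ 2) / n

lemma sum_sub_sampleMean (x : ℕ → ℝ) (n : ℕ) :
    ∑ i ∈ Finset.range n, (x i - sampleMean x n) = 0 := by
  rcases Nat.eq_zero_or_pos n with rfl | hn
  · simp
  · have : (n : ℝ) ≠ 0 := by positivity
    rw [Finset.sum_sub_distrib, sampleMean]
    simp
    field_simp
    simp

lemma sampleVar_eq (x : ℕ → ℝ) (n : ℕ) :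
    sampleVar x n = sampleMean (fun i => x i ^ 2) n - sampleMean x n ^ 2 := by
  rcases Nat.eq_zero_or_pos n with rfl | hn
  · simp [sampleVar, sampleMean]
  · have hn' : (n : ℝ) ≠ 0 := by positivity
    have h1 : ∀ i, (x i - sampleMean x n) ^ 2 =
        x i ^ 2 - sampleMean x n * (2 * x i) + sampleMean x n ^ 2 := fun i => by ring
    have h2 : ∑ i ∈ Finset.range n, x i = n * sampleMean x n := by
      rw [sampleMean]; field_simp
    rw [sampleVar]
    simp_rw [h1]
    rw [Finset.sum_add_distrib, Finset.sum_sub_distrib, ← Finset.mul_sum, ← Finset.mul_sum, h2]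
    simp only [Finset.sum_const, Finset.card_range, nsmul_eq_mul]
    have h3 : sampleMean (fun i => x i ^ 2) n = (∑ i ∈ Finset.range n, x i ^ 2) / n := rfl
    rw [h3]
    field_simp
    ring

/-- The bound obtained from weights that are tilted linearly in the `l`-th coordinate. -/
lemma sum_sampleMean_add_le_coordBound {m q : ℕ} {α : ℝ} (hα : α < 1) {N : Fin m → ℕ}
    (hN : ∀ p, 0 < N p) (y : Fin m → ℕ → EuclideanSpace ℝ (Fin q)) (l : Fin q) {c δ : ℝ}
    (hδ : δ ≤ 1 / 2)
    (hsmall : ∀ p, ∀ j < N p,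
      |c / N p * (y p j l - sampleMean (fun i => y p i l) (N p))| ≤ δ)
    (hr : (1 + 4 * δ) * (c ^ 2 * ∑ p, sampleVar (fun i => y p i l) (N p) / N p) ≤
      chiSqQuantile q (1 - α)) :
    ∑ p, sampleMean (fun i => y p i l) (N p) + c * ∑ p, sampleVar (fun i => y p i l) (N p) / N p
      ≤ coordBound α N (fun p j => y p j) l := by
  have hN' : ∀ p, (0 : ℝ) < N p := fun p => by exact_mod_cast hN p
  set u : Fin m → ℕ → ℝ := fun p j => y p j l - sampleMean (fun i => y p i l) (N p) with hu
  have hu0 : ∀ p, ∑ j ∈ Finset.range (N p), u p j = 0 := fun p => sum_sub_sampleMean _ _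
  have hu2 : ∀ p, ∑ j ∈ Finset.range (N p), u p j ^ 2 =
      N p * sampleVar (fun i => y p i l) (N p) := fun p => by
    rw [sampleVar, mul_div_cancel₀ _ (hN' p).ne']
  have hone : ∀ p, ∀ j < N p, 0 < 1 + c / N p * u p j := fun p j hj => by
    have := (abs_le.1 (hsmall p j hj)).1
    change -δ ≤ c / N p * u p j at this
    linarith
  -- For weights `(1 + ε_pj) / N p` the cost is `∑ ε²` to second order and the gain is `∑ ε_pj u_pj
  -- / N p`, so by Cauchy–Schwarz the best `ε_pj` is proportional to `u_pj / N p`, with one factor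
  -- `c` for all sources.
  set w : (p : Fin m) → Fin (N p) → ℝ := fun p j => (1 + c / N p * u p j) / N p with hw
  have hwpos : ∀ p j, 0 < w p j := fun p j => div_pos (hone p j j.2) (hN' p)
  have hmem : w ∈ ambiguitySet q α N := by
    refine ⟨fun p => ⟨fun j => (hwpos p j).le, ?_⟩, hwpos, ?_⟩
    · rw [Fin.sum_univ_eq_sum_range (fun j => (1 + c / N p * u p j) / N p), ← Finset.sum_div,
        Finset.sum_add_distrib, ← Finset.mul_sum, hu0]
      simp [(hN' p).ne']
    · refine le_trans ?_ hr
      have hlog : ∀ p, -2 * ∑ j, Real.log ((N p : ℝ) * w p j) ≤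
          (1 + 4 * δ) * (c ^ 2 * (sampleVar (fun i => y p i l) (N p) / N p)) := by
        intro p
        have e : ∀ j, (N p : ℝ) * w p j = 1 + c / N p * u p j := fun j => by
          rw [hw]; exact mul_div_cancel₀ _ (hN' p).ne'
        simp_rw [e]
        rw [Fin.sum_univ_eq_sum_range (fun j => Real.log (1 + c / N p * u p j)), Finset.mul_sum]
        calc _ ≤ ∑ j ∈ Finset.range (N p), (-2 * (c / N p * u p j) +
              (1 + 4 * δ) * (c / N p * u p j) ^ 2) :=
              Finset.sum_le_sum fun j hj =>
                neg_two_mul_log_one_add_le hδ (hsmall p j (Finset.mem_range.1 hj))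
          _ = -2 * (c / N p) * (∑ j ∈ Finset.range (N p), u p j) + (1 + 4 * δ) * (c / N p) ^ 2 *
              ∑ j ∈ Finset.range (N p), u p j ^ 2 := by
              rw [Finset.sum_add_distrib, Finset.mul_sum, Finset.mul_sum]
              congr 1 <;> exact Finset.sum_congr rfl fun j _ => by ring
          _ = _ := by
              rw [hu0, hu2]
              have := (hN' p).ne'
              field_simp
              ring
      calc _ = ∑ p, -2 * ∑ j, Real.log ((N p : ℝ) * w p j) := by rw [Finset.mul_sum]
        _ ≤ _ := Finset.sum_le_sum fun p _ => hlog p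
        _ = _ := by rw [← Finset.mul_sum, ← Finset.mul_sum]
  refine (le_of_eq ?_).trans ((isGreatest_coordBound hα hN _ l).2 ⟨_, ⟨w, hmem, rfl⟩, rfl⟩)
  have hp : ∀ p, ∑ j, w p j * y p j l =
      sampleMean (fun i => y p i l) (N p) + c * (sampleVar (fun i => y p i l) (N p) / N p) := by
    intro p
    have hne := (hN' p).ne'
    rw [hw, Fin.sum_univ_eq_sum_range (fun j => (1 + c / N p * u p j) / N p * y p j l)]
    have e : ∀ j, (1 + c / N p * u p j) / N p * y p j l = y p j l / N p +
        (c / N p ^ 2 * u p j ^ 2 + c / N p ^ 2 * sampleMean (fun i => y p i l) (N p) * u p j) := by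
      intro j
      have : y p j l = u p j + sampleMean (fun i => y p i l) (N p) := by simp [hu]
      rw [this]
      field_simp
    simp_rw [e]
    rw [Finset.sum_add_distrib, Finset.sum_add_distrib, ← Finset.mul_sum, ← Finset.mul_sum,
      hu0, hu2, ← Finset.sum_div]
    rw [sampleMean]
    field_simp
    ring
  simp only [WithLp.ofLp_sum, Finset.sum_apply, PiLp.smul_apply, smul_eq_mul]
  simp_rw [hp]
  rw [Finset.sum_add_distrib, Finset.mul_sum]

/-! ### Growth of sequences whose averages converge. -/

lemma tendsto_sampleVar {x : ℕ → ℝ} {a s : ℝ} (ha : Tendsto (sampleMean x) atTop (𝓝 a))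
    (hs : Tendsto (sampleMean fun i => x i ^ 2) atTop (𝓝 s)) :
    Tendsto (sampleVar x) atTop (𝓝 (s - a ^ 2)) :=
  (hs.sub (ha.pow 2)).congr fun n => (sampleVar_eq x n).symm

/-- If the averages of a sequence converge then its terms are `o(n)`. -/
lemma tendsto_div_of_tendsto_sampleMean {x : ℕ → ℝ} {a : ℝ}
    (ha : Tendsto (sampleMean x) atTop (𝓝 a)) :
    Tendsto (fun n : ℕ => x n / n) atTop (𝓝 0) := by
  have h1 : Tendsto (fun n : ℕ => ((n + 1 : ℕ) : ℝ) / n) atTop (𝓝 1) := by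
    have : Tendsto (fun n : ℕ => 1 + 1 / (n : ℝ)) atTop (𝓝 (1 + 0)) :=
      tendsto_const_nhds.add tendsto_one_div_atTop_nhds_zero_nat
    rw [add_zero] at this
    refine this.congr' ?_
    filter_upwards [eventually_gt_atTop 0] with n hn
    have : (n : ℝ) ≠ 0 := by positivity
    push_cast
    field_simp
  -- `x n / n` is `(n + 1) / n` times the mean of `n + 1` terms, minus the mean of `n` terms.
  have h2 := (h1.mul (ha.comp (tendsto_add_atTop_nat 1))).sub ha
  rw [one_mul, sub_self] at h2
  refine h2.congr' ?_
  filter_upwards [eventually_gt_atTop 0] with n hn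
  have hn' : (n : ℝ) ≠ 0 := by positivity
  have hn1 : ((n + 1 : ℕ) : ℝ) ≠ 0 := by positivity
  simp only [Function.comp_apply, sampleMean, Finset.sum_range_succ]
  field_simp
  ring

/-- If the averages of the squares of a sequence converge then `max_{i < n} |x i| = o(√n)`. -/
lemma eventually_forall_abs_le_mul_sqrt {x : ℕ → ℝ} {s : ℝ}
    (hs : Tendsto (sampleMean fun i => x i ^ 2) atTop (𝓝 s)) {δ : ℝ} (hδ : 0 < δ) :
    ∀ᶠ n : ℕ in atTop, ∀ j < n, |x j| ≤ δ * √n := by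
  have h := tendsto_div_of_tendsto_sampleMean hs
  -- Beyond `M`, `x j ^ 2 ≤ δ² j ≤ δ² n`; the finitely many earlier terms are absorbed since `√n →
  -- ∞`.
  obtain ⟨M, hM⟩ := eventually_atTop.1
    ((h.eventually (eventually_le_nhds (show (0 : ℝ) < δ ^ 2 by positivity))).and
      (eventually_gt_atTop 0))
  have hlarge : ∀ᶠ n : ℕ in atTop, ∀ j ∈ Finset.range M, |x j| ≤ δ * √n := by
    rw [Filter.eventually_all_finset]
    intro j _
    exact ((Real.tendsto_sqrt_atTop.comp tendsto_natCast_atTop_atTop).const_mul_atTop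
      hδ).eventually_ge_atTop _
  filter_upwards [hlarge] with n hn j hj
  rcases lt_or_ge j M with hjM | hjM
  · exact hn j (Finset.mem_range.2 hjM)
  · obtain ⟨h1, h2⟩ := hM j hjM
    have hj0 : (0 : ℝ) < j := by exact_mod_cast h2
    rw [div_le_iff₀ hj0] at h1
    refine abs_le_of_sq_le_sq ?_ (by positivity)
    rw [mul_pow, Real.sq_sqrt (by positivity)]
    refine h1.trans ?_
    have : (j : ℝ) ≤ n := by exact_mod_cast hj.le
    gcongr

lemma eventually_forall_abs_sub_sampleMean_le {x : ℕ → ℝ} {a s : ℝ}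
    (ha : Tendsto (sampleMean x) atTop (𝓝 a))
    (hs : Tendsto (sampleMean fun i => x i ^ 2) atTop (𝓝 s)) {δ : ℝ} (hδ : 0 < δ) :
    ∀ᶠ n : ℕ in atTop, ∀ j < n, |x j - sampleMean x n| ≤ δ * √n := by
  have h1 : ∀ᶠ n : ℕ in atTop, |sampleMean x n| ≤ |a| + 1 :=
    ha.abs.eventually (eventually_le_nhds (lt_add_one _))
  have h2 : ∀ᶠ n : ℕ in atTop, |a| + 1 ≤ δ / 2 * √n :=
    ((Real.tendsto_sqrt_atTop.comp tendsto_natCast_atTop_atTop).const_mul_atTop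
      (half_pos hδ)).eventually_ge_atTop _
  filter_upwards [h1, h2, eventually_forall_abs_le_mul_sqrt hs (half_pos hδ)] with n h1 h2 h3 j hj
  have := abs_sub (x j) (sampleMean x n)
  linarith [h3 j hj]

/-! ### The pathwise lower bound for `B` as the samples grow. -/

section SampleSizes

variable {m : ℕ} {N : ℕ → Fin m → ℕ} {β : Fin m → ℝ}

lemma tendsto_sampleSize (hβ : ∀ p, 0 < β p)
    (hn : Tendsto (fun k => avgSize (N k)) atTop atTop)
    (hratio : ∀ p, Tendsto (fun k => (N k p : ℝ) / avgSize (N k)) atTop (𝓝 (β p))) (p : Fin m) :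
    Tendsto (fun k => N k p) atTop atTop := by
  rw [← tendsto_natCast_atTop_iff (R := ℝ)]
  refine ((hratio p).pos_mul_atTop (hβ p) hn).congr' ?_
  filter_upwards [hn.eventually_gt_atTop 0] with k hk
  exact div_mul_cancel₀ _ hk.ne'

lemma tendsto_avgSize_div (hβ : ∀ p, 0 < β p)
    (hratio : ∀ p, Tendsto (fun k => (N k p : ℝ) / avgSize (N k)) atTop (𝓝 (β p))) (p : Fin m) :
    Tendsto (fun k => avgSize (N k) / N k p) atTop (𝓝 (β p)⁻¹) :=
  ((hratio p).inv₀ (hβ p).ne').congr fun _ => inv_div _ _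

/-- For a fixed realisation that obeys the laws of large numbers, the bound `B_l` eventually
exceeds the sum of the sample means by more than `θ / √n`, if `θ² < r V`. -/
lemma eventually_lt_coordBound {q : ℕ} {α : ℝ} (hα : α < 1) (hβ : ∀ p, 0 < β p)
    (hn : Tendsto (fun k => avgSize (N k)) atTop atTop)
    (hratio : ∀ p, Tendsto (fun k => (N k p : ℝ) / avgSize (N k)) atTop (𝓝 (β p)))
    (y : Fin m → ℕ → EuclideanSpace ℝ (Fin q)) (l : Fin q) {a s : Fin m → ℝ}
    (ha : ∀ p, Tendsto (sampleMean fun i => y p i l) atTop (𝓝 (a p)))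
    (hs : ∀ p, Tendsto (sampleMean fun i => y p i l ^ 2) atTop (𝓝 (s p)))
    {V θ : ℝ} (hV : V = ∑ p, (β p)⁻¹ * (s p - a p ^ 2)) (hVpos : 0 < V) (hθ : 0 ≤ θ)
    (hθr : θ ^ 2 < chiSqQuantile q (1 - α) * V) :
    ∀ᶠ k in atTop, ∑ p, sampleMean (fun i => y p i l) (N k p) + θ / √(avgSize (N k)) <
      coordBound α (N k) (fun p j => y p j) l := by
  set r := chiSqQuantile q (1 - α) with hr
  have hNtop := tendsto_sampleSize hβ hn hratio
  obtain ⟨t, htθ, htr⟩ : ∃ t, θ < t ∧ t ^ 2 < r * V := by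
    have hcont : Tendsto (fun t : ℝ => t ^ 2) (𝓝[>] θ) (𝓝 (θ ^ 2)) :=
      ((continuous_pow 2).tendsto θ).mono_left nhdsWithin_le_nhds
    obtain ⟨t, h1, h2⟩ := ((hcont.eventually (eventually_lt_nhds hθr)).and
      self_mem_nhdsWithin).exists
    exact ⟨t, h2, h1⟩
  -- With `c = b√n`, the gain times `√n` tends to `b V = t > θ`, while the cost tends to `b² V = t²
  -- / V < r`.
  set b := t / V with hb
  have hbpos : 0 < b := div_pos (hθ.trans_lt htθ) hVpos
  have hbV : b * V = t := div_mul_cancel₀ _ hVpos.ne'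
  have hb2 : b ^ 2 * V < r := by
    have : b ^ 2 * V * V < r * V := by rw [← hbV] at htr; linarith
    exact lt_of_mul_lt_mul_right this hVpos.le
  -- The strict slack in `b² V < r` pays for the Taylor error `1 + 4δ`.
  obtain ⟨δ, hδ0, hδ1, hδr⟩ : ∃ δ : ℝ, 0 < δ ∧ δ ≤ 1 / 2 ∧ (1 + 4 * δ) * (b ^ 2 * V) < r := by
    have hcont : Tendsto (fun δ : ℝ => (1 + 4 * δ) * (b ^ 2 * V)) (𝓝[>] 0)
        (𝓝 ((1 + 4 * 0) * (b ^ 2 * V))) :=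
      (Continuous.tendsto (by fun_prop) 0).mono_left nhdsWithin_le_nhds
    have h1 := hcont.eventually (eventually_lt_nhds (show (1 + 4 * 0) * (b ^ 2 * V) < r by
      linarith))
    have h2 : ∀ᶠ δ : ℝ in 𝓝[>] 0, δ ≤ 1 / 2 :=
      nhdsWithin_le_nhds (eventually_le_nhds (by norm_num))
    obtain ⟨δ, h1, h2, h3⟩ := (h1.and (h2.and self_mem_nhdsWithin)).exists
    exact ⟨δ, h3, h2, h1⟩
  -- the rescaled variance of the sum of the means converges
  have hvar : Tendsto (fun k => avgSize (N k) *
      ∑ p, sampleVar (fun i => y p i l) (N k p) / N k p) atTop (𝓝 V) := by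
    rw [hV]
    simp_rw [Finset.mul_sum]
    refine tendsto_finsetSum _ fun p _ => ?_
    refine ((tendsto_avgSize_div hβ hratio p).mul
      ((tendsto_sampleVar (ha p) (hs p)).comp (hNtop p))).congr fun k => ?_
    simp only [Function.comp_apply]
    ring
  have hsmall : ∀ p, ∀ᶠ k in atTop, ∀ j < N k p,
      |b * √(avgSize (N k)) / N k p *
        (y p j l - sampleMean (fun i => y p i l) (N k p))| ≤ δ := by
    intro p
    set γ := √(β p)⁻¹ with hγ
    have hγpos : 0 < γ := Real.sqrt_pos.2 (inv_pos.2 (hβ p))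
    -- The centred observations are `o(√(N p))` uniformly, and `b√n / N p` is asymptotically `bγ /
    -- √(N p)`. This choice of constant makes the bound on the tilts tend to `δ / 2`.
    have hδ' : 0 < δ / (2 * (b * γ)) := by positivity
    have hlim : Tendsto (fun k => δ / (2 * (b * γ)) * (b * √(avgSize (N k) / N k p))) atTop
        (𝓝 (δ / (2 * (b * γ)) * (b * γ))) :=
      (((tendsto_avgSize_div hβ hratio p).sqrt).const_mul b).const_mul _
    have hlt : δ / (2 * (b * γ)) * (b * γ) < δ := by
      have : δ / (2 * (b * γ)) * (b * γ) = δ / 2 := by field_simp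
      linarith
    filter_upwards [(hNtop p).eventually
      (eventually_forall_abs_sub_sampleMean_le (ha p) (hs p) hδ'),
      hlim.eventually (eventually_lt_nhds hlt), (hNtop p).eventually_gt_atTop 0] with k h1 h2 h3 j hj
    have hNk : (0 : ℝ) < N k p := by exact_mod_cast h3
    rw [abs_mul, abs_of_nonneg (by positivity)]
    calc _ ≤ b * √(avgSize (N k)) / N k p * (δ / (2 * (b * γ)) * √(N k p)) := by
          gcongr
          exact h1 j hj
      _ = δ / (2 * (b * γ)) * (b * √(avgSize (N k) / N k p)) := by
          rw [Real.sqrt_div' _ hNk.le]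
          have : (N k p : ℝ) = √(N k p) * √(N k p) := (Real.mul_self_sqrt hNk.le).symm
          have h0 : √(N k p : ℝ) ≠ 0 := (Real.sqrt_pos.2 hNk).ne'
          rw [div_mul_eq_mul_div, div_eq_iff hNk.ne']
          nth_rewrite 3 [this]
          field_simp
      _ ≤ δ := h2.le
  have hc : Tendsto (fun k => (1 + 4 * δ) * (b ^ 2 * (avgSize (N k) *
      ∑ p, sampleVar (fun i => y p i l) (N k p) / N k p))) atTop
      (𝓝 ((1 + 4 * δ) * (b ^ 2 * V))) := (hvar.const_mul _).const_mul _
  have hgain : ∀ᶠ k in atTop, θ < b * (avgSize (N k) *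
      ∑ p, sampleVar (fun i => y p i l) (N k p) / N k p) :=
    (hvar.const_mul b).eventually (eventually_gt_nhds (by rw [hbV]; exact htθ))
  filter_upwards [eventually_all.2 hsmall, hc.eventually (eventually_lt_nhds hδr), hgain,
    hn.eventually_gt_atTop 0, eventually_all.2 fun p => (hNtop p).eventually_gt_atTop 0]
    with k h1 h2 h3 h4 h5
  have hsq : √(avgSize (N k)) ^ 2 = avgSize (N k) := Real.sq_sqrt h4.le
  have hsq0 : 0 < √(avgSize (N k)) := Real.sqrt_pos.2 h4
  have hmain := sum_sampleMean_add_le_coordBound hα h5 y l hδ1 h1 (by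
    refine le_trans (le_of_eq ?_) h2.le
    rw [mul_pow, hsq]
    ring)
  refine lt_of_lt_of_le ?_ hmain
  gcongr
  rw [div_lt_iff₀ hsq0]
  refine h3.trans_eq ?_
  nth_rewrite 1 [← hsq]
  ring

end SampleSizes

/-! ### Almost sure events and the scalar central limit theorem. -/

section Laws

variable {Ω : Type*} [MeasurableSpace Ω] {P : Measure Ω}

lemma ae_tendsto_sampleMean {X : ℕ → Ω → ℝ} {Z : Ω → ℝ} (hZ : Integrable Z P)
    (hident : ∀ i, IdentDistrib (X i) Z P P) (hindep : iIndepFun X P) :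
    ∀ᵐ ω ∂P, Tendsto (sampleMean fun i => X i ω) atTop (𝓝 (∫ ω, Z ω ∂P)) := by
  have h := strong_law_ae_real X ((hident 0).integrable_iff.2 hZ)
    (fun i j hij => hindep.indepFun hij) (fun i => (hident i).trans (hident 0).symm)
  rw [(hident 0).integral_eq] at h
  exact h

variable [IsProbabilityMeasure P]

/-- Sets that almost surely contain the sample point eventually may be disregarded in the lower
limit of probabilities. -/
lemma liminf_measure_le_of_ae_eventually {D E A : ℕ → Set Ω}
    (hD : ∀ k, NullMeasurableSet (D k) P) (hE : ∀ᵐ ω ∂P, ∀ᶠ k in atTop, ω ∈ E k)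
    (hA : ∀ k, D k ∩ E k ⊆ A k) :
    liminf (fun k => P (D k)) atTop ≤ liminf (fun k => P (A k)) atTop := by
  set F : ℕ → Set Ω := fun K => {ω | ∀ k ≥ K, ω ∈ E k} with hF
  have hmono : Monotone F := fun K K' hK ω hω k hk => hω k (le_trans hK hk)
  have hunion : P (⋃ K, F K) = 1 := by
    rw [← measure_univ (μ := P)]
    refine measure_congr (eventuallyEq_univ.2 ?_)
    filter_upwards [hE] with ω hω
    obtain ⟨K, hK⟩ := eventually_atTop.1 hω
    exact Set.mem_iUnion.2 ⟨K, hK⟩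
  -- Continuity from below along a monotone family needs no measurability, so measurability of
  -- `coordBound` in the sample point is never required.
  have hlim : Tendsto (fun k => P (F k)) atTop (𝓝 1) := by
    rw [← hunion]
    exact tendsto_measure_iUnion_atTop hmono
  have hlim' : Tendsto (fun k => 1 - P (F k)) atTop (𝓝 0) := by
    have := ENNReal.Tendsto.sub (tendsto_const_nhds (x := (1 : ENNReal))) hlim
      (Or.inl ENNReal.one_ne_top)
    rwa [tsub_self] at this
  rw [← ENNReal.liminf_add_of_right_tendsto_zero hlim' (fun k => P (A k))]
  refine liminf_le_liminf (Eventually.of_forall fun k => ?_)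
  have h1 : P (F k) ≤ P (A k) + P (D k)ᶜ := by
    rw [← measure_inter_add_sdiff₀ (F k) (hD k)]
    gcongr
    · exact fun ω hω => hA k ⟨hω.2, hω.1 k le_rfl⟩
    · exact fun ω hω => hω.2
  have h2 : P (D k) + P (D k)ᶜ = 1 := by
    rw [measure_add_measure_compl₀ (hD k), measure_univ]
  have h3 : P (F k) + (1 - P (F k)) = 1 := add_tsub_cancel_of_le prob_le_one
  have h4 : P (D k)ᶜ ≠ ⊤ := measure_ne_top _ _
  refine (ENNReal.add_le_add_iff_right h4).1 ?_
  calc _ = P (F k) + (1 - P (F k)) := h2.trans h3.symm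
    _ ≤ P (A k) + P (D k)ᶜ + (1 - P (F k)) := by gcongr
    _ = _ := by simp only [Pi.add_apply]; ring

/-- The one-dimensional central limit theorem along a sequence of sample sizes and with general
scaling factors, in terms of characteristic functions. -/
lemma tendsto_charFun_centered_sum {X : ℕ → Ω → ℝ} {Z : Ω → ℝ} (hZ : MemLp Z 2 P)
    (hident : ∀ i, IdentDistrib (X i) Z P P) (hindep : iIndepFun X P)
    {n : ℕ → ℕ} (hn : Tendsto n atTop atTop) {c : ℕ → ℝ} {a : ℝ}
    (hc : Tendsto (fun k => √(n k) * c k) atTop (𝓝 a)) :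
    Tendsto (fun k => charFun (P.map fun ω => ∑ j ∈ Finset.range (n k),
      c k * (X j ω - ∫ ω, Z ω ∂P)) 1) atTop (𝓝 (Complex.exp (-(a ^ 2 * Var[Z; P] : ℝ) / 2))) := by
  have hid0 : ∀ i, IdentDistrib (X i) (X 0) P P := fun i => (hident i).trans (hident 0).symm
  have hclt := tendstoInDistribution_inv_sqrt_mul_sum_sub (P := P) (X := X)
    (P' := gaussianReal 0 Var[X 0; P].toNNReal) (Y := id) HasLaw.id
    ((hident 0).memLp_iff.2 hZ) hindep hid0
  have hcomp : TendstoInDistribution (fun k ω => (√(n k))⁻¹ *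
      (∑ j ∈ Finset.range (n k), X j ω - n k * ∫ ω, X 0 ω ∂P)) atTop id (fun _ => P)
      (gaussianReal 0 Var[X 0; P].toNNReal) :=
    ⟨fun k => hclt.forall_aemeasurable (n k), hclt.aemeasurable_limit, hclt.tendsto.comp hn⟩
  -- Slutsky: the normalised sum is multiplied by `√(n k) * c k`, which tends to `a`.
  have hsl := hcomp.continuous_comp_prodMk_of_tendstoInMeasure_const
    (Y := fun k _ => √(n k) * c k) (c := a) (g := fun x : ℝ × ℝ => x.2 * x.1) (by fun_prop)
    (tendstoInMeasure_of_tendsto_ae (fun k => aestronglyMeasurable_const)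
      (Eventually.of_forall fun _ => hc)) (fun k => aemeasurable_const)
  have hchar := ProbabilityMeasure.tendsto_iff_tendsto_charFun.1 hsl.tendsto 1
  simp only [ProbabilityMeasure.coe_mk, id] at hchar
  rw [charFun_map_mul, charFun_gaussianReal] at hchar
  convert hchar using 2
  · rename_i k
    congr 2
    ext ω
    rw [(hident 0).integral_eq, ← Finset.mul_sum, Finset.sum_sub_distrib]
    simp only [Finset.sum_const, Finset.card_range, nsmul_eq_mul]
    rcases Nat.eq_zero_or_pos (n k) with h | h
    · simp [h]
    · have : √(n k : ℝ) ≠ 0 := (Real.sqrt_pos.2 (by exact_mod_cast h)).ne'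
      field_simp
  · rw [(hident 0).variance_eq]
    congr 1
    have : (((Var[Z; P]).toNNReal : ℝ) : ℂ) = (Var[Z; P] : ℝ) := by
      rw [Real.coe_toNNReal _ (variance_nonneg _ _)]
    push_cast at this ⊢
    rw [this]
    ring

end Laws

/-! ### The multi-sample central limit theorem. -/

section MultivariateCLT

variable {Ω : Type*} [MeasurableSpace Ω] {P : Measure Ω} {m q : ℕ}

/-- The covariance matrix of the limit law of the sum of the sample means, rescaled by `√n`. -/
noncomputable def limitCovariance (P : Measure Ω) (Y : Fin m → Ω → EuclideanSpace ℝ (Fin q))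
    (β : Fin m → ℝ) : Matrix (Fin q) (Fin q) ℝ :=
  ∑ p, (β p)⁻¹ • covarianceMatrix P (Y p)

/-- The deviation of the sum of the sample means from its limit, rescaled by `√n`. -/
noncomputable def scaledDeviation (P : Measure Ω) (Y : Fin m → Ω → EuclideanSpace ℝ (Fin q))
    (S : Fin m → ℕ → Ω → EuclideanSpace ℝ (Fin q)) (N : Fin m → ℕ) (ω : Ω) :
    EuclideanSpace ℝ (Fin q) :=
  √(avgSize N) • (∑ p, (N p : ℝ)⁻¹ • ∑ j ∈ Finset.range (N p), S p j ω - ∑ p, ∫ ω', Y p ω' ∂P)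

lemma memLp_apply {Z : Ω → EuclideanSpace ℝ (Fin q)} (hZ : MemLp Z 2 P) (l : Fin q) :
    MemLp (fun ω => Z ω l) 2 P :=
  (EuclideanSpace.proj (𝕜 := ℝ) l).comp_memLp' hZ

lemma memLp_inner {Z : Ω → EuclideanSpace ℝ (Fin q)} (hZ : MemLp Z 2 P)
    (t : EuclideanSpace ℝ (Fin q)) : MemLp (fun ω => inner ℝ (Z ω) t) 2 P := by
  simp_rw [real_inner_comm]
  exact (innerSL ℝ t).comp_memLp' hZ

open Matrix in
lemma variance_inner [IsFiniteMeasure P] {Z : Ω → EuclideanSpace ℝ (Fin q)} (hZ : MemLp Z 2 P)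
    (t : EuclideanSpace ℝ (Fin q)) :
    Var[fun ω => inner ℝ (Z ω) t; P] = t.ofLp ⬝ᵥ (covarianceMatrix P Z *ᵥ t.ofLp) := by
  have h : (fun ω => inner ℝ (Z ω) t) = fun ω => ∑ i, t i * Z ω i := by
    ext ω
    simp [PiLp.inner_apply]
  have hm : ∀ i, MemLp (fun ω => t i * Z ω i) 2 P := fun i => (memLp_apply hZ i).const_mul _
  rw [← covariance_self (memLp_inner hZ t).aemeasurable, h,
    covariance_fun_sum_fun_sum hm hm]
  simp only [covariance_const_mul_left, covariance_const_mul_right, dotProduct, mulVec,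
    covarianceMatrix, of_apply, Finset.mul_sum]
  exact Finset.sum_congr rfl fun i _ => Finset.sum_congr rfl fun j _ => by ring

lemma aemeasurable_scaledDeviation {Y : Fin m → Ω → EuclideanSpace ℝ (Fin q)}
    {S : Fin m → ℕ → Ω → EuclideanSpace ℝ (Fin q)} (hS : ∀ p j, AEMeasurable (S p j) P)
    (N : Fin m → ℕ) : AEMeasurable (scaledDeviation P Y S N) P := by
  unfold scaledDeviation
  fun_prop

lemma inner_scaledDeviation {Y : Fin m → Ω → EuclideanSpace ℝ (Fin q)}
    (hY : ∀ p, Integrable (Y p) P) {S : Fin m → ℕ → Ω → EuclideanSpace ℝ (Fin q)}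
    {N : Fin m → ℕ} (hN : ∀ p, 0 < N p) (ω : Ω) (t : EuclideanSpace ℝ (Fin q)) :
    inner ℝ (scaledDeviation P Y S N ω) t = ∑ p, ∑ j ∈ Finset.range (N p),
      √(avgSize N) / N p * (inner ℝ (S p j ω) t - ∫ ω', inner ℝ (Y p ω') t ∂P) := by
  have hint : ∀ p, ∫ ω', inner ℝ (Y p ω') t ∂P = inner ℝ (∫ ω', Y p ω' ∂P) t := fun p => by
    simp_rw [real_inner_comm t]
    exact integral_inner (hY p) t
  rw [scaledDeviation, real_inner_smul_left, ← Finset.sum_sub_distrib, sum_inner, Finset.mul_sum]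
  refine Finset.sum_congr rfl fun p _ => ?_
  have : (N p : ℝ) ≠ 0 := by exact_mod_cast (hN p).ne'
  rw [hint, ← Finset.mul_sum, Finset.sum_sub_distrib, inner_sub_left, real_inner_smul_left,
    sum_inner]
  simp only [Finset.sum_const, Finset.card_range, nsmul_eq_mul]
  field_simp

lemma posSemidef_limitCovariance {Y : Fin m → Ω → EuclideanSpace ℝ (Fin q)}
    (hcov : ∀ p, (covarianceMatrix P (Y p)).PosDef) {β : Fin m → ℝ} (hβ : ∀ p, 0 < β p) :
    (limitCovariance P Y β).PosSemidef :=
  Matrix.posSemidef_sum _ fun p _ => (hcov p).posSemidef.smul (inv_pos.2 (hβ p)).le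

lemma limitCovariance_apply (Y : Fin m → Ω → EuclideanSpace ℝ (Fin q)) (β : Fin m → ℝ)
    (i j : Fin q) :
    limitCovariance P Y β i j = ∑ p, (β p)⁻¹ * covarianceMatrix P (Y p) i j := by
  simp [limitCovariance, Matrix.sum_apply]

lemma limitCovariance_diag_pos [Nonempty (Fin m)] {Y : Fin m → Ω → EuclideanSpace ℝ (Fin q)}
    (hcov : ∀ p, (covarianceMatrix P (Y p)).PosDef) {β : Fin m → ℝ} (hβ : ∀ p, 0 < β p)
    (l : Fin q) : 0 < limitCovariance P Y β l l := by
  rw [limitCovariance_apply]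
  exact Finset.sum_pos (fun p _ => mul_pos (inv_pos.2 (hβ p)) (hcov p).diag_pos)
    Finset.univ_nonempty

/-- Projecting on `t` leaves a scalar sum of independent terms; grouping its factors by source lets
the scalar limit theorem be applied to each source separately. -/
lemma charFun_scaledDeviation {Y : Fin m → Ω → EuclideanSpace ℝ (Fin q)}
    (hY : ∀ p, Integrable (Y p) P) {S : Fin m → ℕ → Ω → EuclideanSpace ℝ (Fin q)}
    (hS : ∀ p j, AEMeasurable (S p j) P)
    (hindep : iIndepFun (fun pj : Fin m × ℕ => S pj.1 pj.2) P)
    {N : Fin m → ℕ} (hN : ∀ p, 0 < N p) (t : EuclideanSpace ℝ (Fin q)) :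
    charFun (P.map (scaledDeviation P Y S N)) t =
      ∏ p, charFun (P.map fun ω => ∑ j ∈ Finset.range (N p),
        √(avgSize N) / N p * (inner ℝ (S p j ω) t - ∫ ω', inner ℝ (Y p ω') t ∂P)) 1 := by
  -- A sigma type is used as index so that the observed pairs, whose range of `j` depends on `p`,
  -- form a `Finset.sigma`.
  set W : (Σ _ : Fin m, ℕ) → Ω → ℝ := fun x ω => √(avgSize N) / N x.1 *
    (inner ℝ (S x.1 x.2 ω) t - ∫ ω', inner ℝ (Y x.1 ω') t ∂P) with hW
  have hWm : ∀ x, AEMeasurable (W x) P := fun x => by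
    have := hS x.1 x.2
    fun_prop
  have hWi : iIndepFun W P := by
    have h1 : iIndepFun (fun x : (Σ _ : Fin m, ℕ) => S x.1 x.2) P :=
      hindep.precomp (g := fun x : (Σ _ : Fin m, ℕ) => (x.1, x.2)) (by
        rintro ⟨a, b⟩ ⟨c, d⟩ h
        simpa using h)
    exact h1.comp (fun x y => √(avgSize N) / N x.1 *
      (inner ℝ y t - ∫ ω', inner ℝ (Y x.1 ω') t ∂P)) (fun x => by fun_prop)
  have hp : ∀ p, charFun (P.map fun ω => ∑ j ∈ Finset.range (N p), W ⟨p, j⟩ ω) =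
      ∏ j ∈ Finset.range (N p), charFun (P.map (W ⟨p, j⟩)) := fun p => by
    refine iIndepFun.charFun_map_fun_finsetSum_eq_prod (fun j _ => hWm _) ?_
    exact (hWi.precomp (g := fun j => (⟨p, j⟩ : Σ _ : Fin m, ℕ)) (by
      intro a b h; simpa using h)).restrict _
  have htot : charFun (P.map fun ω => inner ℝ (scaledDeviation P Y S N ω) t) =
      ∏ x ∈ Finset.univ.sigma fun p => Finset.range (N p), charFun (P.map (W x)) := by
    rw [← iIndepFun.charFun_map_fun_finsetSum_eq_prod (fun x _ => hWm x) (hWi.restrict _)]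
    congr 2
    ext ω
    rw [inner_scaledDeviation hY hN, Finset.sum_sigma]
  have hone : charFun (P.map (scaledDeviation P Y S N)) t =
      charFun (P.map fun ω => inner ℝ (scaledDeviation P Y S N ω) t) 1 := by
    have hm := aemeasurable_scaledDeviation (Y := Y) hS N
    rw [charFun_apply, charFun_apply, integral_map hm (by fun_prop),
      integral_map (by fun_prop) (by fun_prop)]
    simp
  rw [hone, htot, Finset.prod_sigma, Finset.prod_apply]
  simp_rw [← hp]
  rfl

variable [IsProbabilityMeasure P]

/-- The multi-sample multivariate central limit theorem: if the sample sizes grow proportionally,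
the rescaled deviation of the sum of the sample means is asymptotically normal. The conclusion is
stated as the portmanteau inequality for open sets. -/
lemma le_liminf_measure_scaledDeviation_mem {Y : Fin m → Ω → EuclideanSpace ℝ (Fin q)}
    (hL2 : ∀ p, MemLp (Y p) 2 P) (hcov : ∀ p, (covarianceMatrix P (Y p)).PosDef)
    {S : Fin m → ℕ → Ω → EuclideanSpace ℝ (Fin q)}
    (hident : ∀ p j, IdentDistrib (S p j) (Y p) P P)
    (hindep : iIndepFun (fun pj : Fin m × ℕ => S pj.1 pj.2) P)
    {N : ℕ → Fin m → ℕ} {β : Fin m → ℝ} (hβ : ∀ p, 0 < β p)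
    (hn : Tendsto (fun k => avgSize (N k)) atTop atTop)
    (hratio : ∀ p, Tendsto (fun k => (N k p : ℝ) / avgSize (N k)) atTop (𝓝 (β p)))
    {G : Set (EuclideanSpace ℝ (Fin q))} (hG : IsOpen G) :
    multivariateGaussian 0 (limitCovariance P Y β) G ≤
      liminf (fun k => P (scaledDeviation P Y S (N k) ⁻¹' G)) atTop := by
  have hS : ∀ p j, AEMeasurable (S p j) P := fun p j => (hident p j).aemeasurable_fst
  have hY : ∀ p, Integrable (Y p) P := fun p => (hL2 p).integrable (by norm_num)
  have hm : ∀ k, AEMeasurable (scaledDeviation P Y S (N k)) P := fun k =>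
    aemeasurable_scaledDeviation hS (N k)
  have hNtop := tendsto_sampleSize hβ hn hratio
  let law : ℕ → ProbabilityMeasure (EuclideanSpace ℝ (Fin q)) := fun k =>
    ⟨P.map (scaledDeviation P Y S (N k)), Measure.isProbabilityMeasure_map (hm k)⟩
  let lim : ProbabilityMeasure (EuclideanSpace ℝ (Fin q)) :=
    ⟨multivariateGaussian 0 (limitCovariance P Y β), inferInstance⟩
  have key : Tendsto law atTop (𝓝 lim) := by
    refine ProbabilityMeasure.tendsto_iff_tendsto_charFun.2 fun t => ?_
    simp only [law, lim, ProbabilityMeasure.coe_mk]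
    have hfac : ∀ p, Tendsto (fun k => charFun (P.map fun ω => ∑ j ∈ Finset.range (N k p),
        √(avgSize (N k)) / N k p * (inner ℝ (S p j ω) t - ∫ ω', inner ℝ (Y p ω') t ∂P)) 1) atTop
        (𝓝 (Complex.exp (-(√(β p)⁻¹ ^ 2 * Var[fun ω => inner ℝ (Y p ω) t; P] : ℝ) / 2))) := by
      intro p
      refine tendsto_charFun_centered_sum (X := fun j ω => inner ℝ (S p j ω) t)
        (memLp_inner (hL2 p) t) (fun j => (hident p j).comp (u := fun y => inner ℝ y t)
        (by fun_prop)) ?_ (hNtop p) (c := fun k => √(avgSize (N k)) / N k p) ?_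
      · have h1 : iIndepFun (fun j => S p j) P :=
          hindep.precomp (g := fun j => (p, j)) fun a b h => by simpa using h
        exact h1.comp (fun _ y => inner ℝ y t) fun _ => by fun_prop
      -- `√(N p) · √n / N p = √(n / N p)`, which tends to `√(β p)⁻¹`.
      · refine (tendsto_avgSize_div hβ hratio p).sqrt.congr fun k => ?_
        rw [Real.sqrt_div' _ (Nat.cast_nonneg _), mul_div_left_comm, Real.sqrt_div_self,
          div_eq_mul_inv]
    have hprod := tendsto_finsetProd Finset.univ fun p _ => hfac p
    rw [← Complex.exp_sum] at hprod
    have hlim : (∑ p, (-(√(β p)⁻¹ ^ 2 * Var[fun ω => inner ℝ (Y p ω) t; P] : ℝ) / 2 : ℂ)) =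
        inner ℝ t 0 * Complex.I -
          (t.ofLp ⬝ᵥ Matrix.mulVec (limitCovariance P Y β) t.ofLp : ℝ) / 2 := by
      have e : t.ofLp ⬝ᵥ Matrix.mulVec (limitCovariance P Y β) t.ofLp =
          ∑ p, √(β p)⁻¹ ^ 2 * Var[fun ω => inner ℝ (Y p ω) t; P] := by
        rw [limitCovariance, Matrix.sum_mulVec, dotProduct_sum]
        refine Finset.sum_congr rfl fun p _ => ?_
        rw [variance_inner (hL2 p), Real.sq_sqrt (inv_pos.2 (hβ p)).le, Matrix.smul_mulVec,
          dotProduct_smul, smul_eq_mul]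
      rw [e, ← Finset.sum_div, Finset.sum_neg_distrib]
      push_cast
      simp
      ring
    rw [charFun_multivariateGaussian (posSemidef_limitCovariance hcov hβ)]
    rw [hlim] at hprod
    refine hprod.congr' ?_
    filter_upwards [eventually_all.2 fun p => (hNtop p).eventually_gt_atTop 0] with k hk
    exact (charFun_scaledDeviation hY hS hindep hk t).symm
  refine (ProbabilityMeasure.le_liminf_measure_open_of_tendsto key hG).trans_eq ?_
  congr 1
  ext k
  rw [ProbabilityMeasure.coe_mk, Measure.map_apply_of_aemeasurable (hm k) hG.measurableSet]

end MultivariateCLT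

/-! ### Gaussian mass of the orthant. -/

section GaussianBound

variable {q : ℕ}

lemma chiSqLaw_eq_map_stdGaussian (q : ℕ) :
    chiSqLaw q = (stdGaussian (EuclideanSpace ℝ (Fin q))).map fun z => ‖z‖ ^ 2 := by
  rw [← map_pi_eq_stdGaussian, Measure.map_map (by fun_prop) (by fun_prop), chiSqLaw]
  congr 1
  ext x
  simp [EuclideanSpace.real_norm_sq_eq]

/-- A vanishing sum of squares forces the point into a coordinate hyperplane, which is null. This
makes the quantile positive, leaving room for `0 < s < √r`. -/
lemma chiSqLaw_Iic_zero [Nonempty (Fin q)] : chiSqLaw q (Set.Iic 0) = 0 := by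
  have hna : NullSingletonClass (gaussianReal 0 1) := nullSingletonClass_gaussianReal one_ne_zero
  rw [chiSqLaw, Measure.map_apply (by fun_prop) measurableSet_Iic]
  let i : Fin q := Classical.arbitrary _
  refine measure_mono_null (fun x hx => ?_)
    (Measure.pi_hyperplane (fun _ : Fin q => gaussianReal 0 1) i 0)
  have h1 : ∑ i, x i ^ 2 ≤ 0 := hx
  have h2 : x i ^ 2 ≤ ∑ i, x i ^ 2 :=
    Finset.single_le_sum (f := fun i => x i ^ 2) (fun _ _ => sq_nonneg _) (Finset.mem_univ i)
  exact pow_eq_zero_iff two_ne_zero |>.1 (le_antisymm (h2.trans h1) (sq_nonneg _))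

lemma chiSqQuantile_pos [Nonempty (Fin q)] {u : ℝ} (hu : 0 < u) (hu1 : u < 1) :
    0 < chiSqQuantile q u := by
  refine lt_of_le_of_ne (chiSqQuantile_nonneg q hu) fun h => ?_
  have := le_chiSqLaw_Iic_chiSqQuantile q hu1
  rw [← h, measureReal_def, chiSqLaw_Iic_zero] at this
  simp at this
  linarith

open Matrix in
open scoped MatrixOrder in
/-- The ellipsoid of a centred Gaussian law lies in the orthant that is bounded by its supporting
hyperplanes; its mass is given by the `χ²` law. -/
lemma chiSqLaw_Iic_le_multivariateGaussian {V : Matrix (Fin q) (Fin q) ℝ} (hV : V.PosSemidef)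
    (hdiag : ∀ l, 0 < V l l) (r : ℝ) :
    chiSqLaw q (Set.Iic r) ≤
      multivariateGaussian 0 V {x | ∀ l, -x l < √r * √(V l l)} := by
  have hclosed : IsClosed {x : EuclideanSpace ℝ (Fin q) | ∀ l, -x l ≤ √r * √(V l l)} := by
    rw [Set.ofPred_forall]
    exact isClosed_iInter fun l => isClosed_le (by fun_prop) (by fun_prop)
  -- Each coordinate has a nondegenerate normal law, so the bounding hyperplanes are null. The
  -- strict inequalities make the orthant open, as the portmanteau inequality demands.
  have hne : ∀ᵐ x ∂(multivariateGaussian 0 V), ∀ l, -x l ≠ √r * √(V l l) := by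
    refine ae_all_iff.2 fun l => ?_
    have hmp := measurePreserving_eval_multivariateGaussian (μ := 0) hV (i := l)
    have hna : NullSingletonClass (gaussianReal ((0 : EuclideanSpace ℝ (Fin q)) l)
        (V l l).toNNReal) :=
      nullSingletonClass_gaussianReal (Real.toNNReal_pos.2 (hdiag l)).ne'
    have h := hmp.quasiMeasurePreserving.ae
      (compl_mem_ae_iff.2 (measure_singleton (-(√r * √(V l l)))))
    filter_upwards [h] with x hx hx'
    exact hx (by rw [Set.mem_singleton_iff, ← hx', neg_neg])
  have hstep : multivariateGaussian 0 V {x | ∀ l, -x l ≤ √r * √(V l l)} ≤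
      multivariateGaussian 0 V {x | ∀ l, -x l < √r * √(V l l)} := by
    refine measure_mono_ae ?_
    filter_upwards [hne] with x hx hx' l
    exact lt_of_le_of_ne (hx' l) (hx l)
  refine le_trans ?_ hstep
  rw [chiSqLaw_eq_map_stdGaussian, Measure.map_apply (by fun_prop) measurableSet_Iic,
    multivariateGaussian, Measure.map_apply (by fun_prop) hclosed.measurableSet]
  refine measure_mono fun z hz l => ?_
  have hz' : ‖z‖ ≤ √r := Real.le_sqrt_of_sq_le hz
  -- With `A = V^{1/2}` and `x = A z`, the coordinate `x_l` is `⟪A e_l, z⟫`, and `‖A e_l‖² = ⟪e_l, V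
  -- e_l⟫ = V_ll`.
  set A := toEuclideanCLM (𝕜 := ℝ) (n := Fin q) (CFC.sqrt V) with hA
  set e : EuclideanSpace ℝ (Fin q) := EuclideanSpace.single l 1 with he
  have hsa : ContinuousLinearMap.adjoint A = A :=
    IsSelfAdjoint.adjoint_eq ((CFC.sqrt_nonneg V).isSelfAdjoint.map _)
  have hcoord : (0 + A z) l = inner ℝ (A e) z := by
    rw [zero_add, ← hsa, ContinuousLinearMap.adjoint_inner_left, hsa, he]
    simp [EuclideanSpace.inner_single_left]
  have hnorm : ‖A e‖ = √(V l l) := by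
    rw [norm_eq_sqrt_real_inner]
    congr 1
    nth_rewrite 1 [← hsa]
    rw [ContinuousLinearMap.adjoint_inner_left, ← ContinuousLinearMap.comp_apply,
      ← ContinuousLinearMap.mul_def, hA, ← map_mul, CFC.sqrt_mul_sqrt_self _ hV.nonneg,
      inner_toEuclideanCLM, he]
    simp
  change -(0 + A z) l ≤ √r * √(V l l)
  rw [hcoord, mul_comm, ← hnorm]
  calc _ ≤ |inner ℝ (A e) z| := neg_le_abs _
    _ ≤ ‖A e‖ * ‖z‖ := abs_real_inner_le_norm _ _
    _ ≤ _ := by gcongr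

lemma isOpen_orthant (d : Fin q → ℝ) : IsOpen {x : EuclideanSpace ℝ (Fin q) | ∀ l, -x l < d l} := by
  rw [Set.ofPred_forall]
  exact isOpen_iInter_of_finite fun l => isOpen_lt (by fun_prop) (by fun_prop)

/-- Continuity from below along `s ↑ r`. It recovers the critical radius, since the bound on `B` is
available only strictly below it. -/
lemma measure_orthant_le {μ : Measure (EuclideanSpace ℝ (Fin q))} {d : Fin q → ℝ}
    (hd : ∀ l, 0 ≤ d l) {r : ℝ} (hr : 0 < r) {L : ENNReal}
    (h : ∀ s, 0 < s → s < r → μ {x | ∀ l, -x l < s * d l} ≤ L) :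
    μ {x | ∀ l, -x l < r * d l} ≤ L := by
  obtain ⟨s, hs_mono, hs_mem, hs_lim⟩ := exists_seq_strictMono_tendsto' hr
  have hmono : Monotone fun i => {x : EuclideanSpace ℝ (Fin q) | ∀ l, -x l < s i * d l} :=
    fun i j hij x hx l => (hx l).trans_le
      (mul_le_mul_of_nonneg_right (hs_mono.monotone hij) (hd l))
  have hsub : {x : EuclideanSpace ℝ (Fin q) | ∀ l, -x l < r * d l} ⊆
      ⋃ i, {x | ∀ l, -x l < s i * d l} := by
    intro x hx
    have : ∀ᶠ i in atTop, ∀ l, -x l < s i * d l := eventually_all.2 fun l =>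
      (hs_lim.mul_const (d l)).eventually (eventually_gt_nhds (hx l))
    obtain ⟨i, hi⟩ := this.exists
    exact Set.mem_iUnion.2 ⟨i, hi⟩
  refine (measure_mono hsub).trans ?_
  rw [hmono.measure_iUnion]
  exact iSup_le fun i => h _ (hs_mem i).1 (hs_mem i).2

end GaussianBound

/-! ### Coverage probability. -/

section Coverage

variable {Ω : Type*} [MeasurableSpace Ω] {P : Measure Ω} {m q : ℕ}

lemma scaledDeviation_apply (Y : Fin m → Ω → EuclideanSpace ℝ (Fin q))
    (S : Fin m → ℕ → Ω → EuclideanSpace ℝ (Fin q)) (N : Fin m → ℕ) (ω : Ω) (l : Fin q) :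
    scaledDeviation P Y S N ω l = √(avgSize N) *
      (∑ p, sampleMean (fun i => S p i ω l) (N p) - (∑ p, ∫ ω', Y p ω' ∂P) l) := by
  simp only [scaledDeviation, sampleMean, PiLp.smul_apply, PiLp.sub_apply, WithLp.ofLp_sum,
    Finset.sum_apply, smul_eq_mul, div_eq_inv_mul]

variable [IsProbabilityMeasure P]

/-- The strong laws for the coordinates and their squares, finitely many in number, hold off one
null set; there the pathwise bound applies with `θ = s √V_ll`. -/
lemma ae_eventually_lt_coordBound [Nonempty (Fin m)] {α : ℝ} (hα : α < 1)
    {Y : Fin m → Ω → EuclideanSpace ℝ (Fin q)} (hL2 : ∀ p, MemLp (Y p) 2 P)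
    (hcov : ∀ p, (covarianceMatrix P (Y p)).PosDef)
    {S : Fin m → ℕ → Ω → EuclideanSpace ℝ (Fin q)}
    (hident : ∀ p j, IdentDistrib (S p j) (Y p) P P)
    (hindep : iIndepFun (fun pj : Fin m × ℕ => S pj.1 pj.2) P)
    {N : ℕ → Fin m → ℕ} {β : Fin m → ℝ} (hβ : ∀ p, 0 < β p)
    (hn : Tendsto (fun k => avgSize (N k)) atTop atTop)
    (hratio : ∀ p, Tendsto (fun k => (N k p : ℝ) / avgSize (N k)) atTop (𝓝 (β p)))
    {s : ℝ} (hs : 0 ≤ s) (hsr : s ^ 2 < chiSqQuantile q (1 - α)) :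
    ∀ᵐ ω ∂P, ∀ᶠ k in atTop, ∀ l, ∑ p, sampleMean (fun i => S p i ω l) (N k p) +
      s * √(limitCovariance P Y β l l) / √(avgSize (N k)) <
        coordBound α (N k) (fun p j => S p j ω) l := by
  have hSi : ∀ p, iIndepFun (fun j => S p j) P := fun p =>
    hindep.precomp (g := fun j => (p, j)) fun a b h => by simpa using h
  have h1 : ∀ᵐ ω ∂P, ∀ p l, Tendsto (sampleMean fun i => S p i ω l) atTop
      (𝓝 (∫ ω, Y p ω l ∂P)) := ae_all_iff.2 fun p => ae_all_iff.2 fun l =>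
    ae_tendsto_sampleMean (X := fun i ω => S p i ω l)
      ((memLp_apply (hL2 p) l).integrable (by norm_num))
      (fun i => (hident p i).comp (u := fun y : EuclideanSpace ℝ (Fin q) => y l) (by fun_prop))
      ((hSi p).comp (fun _ y => y l) fun _ => by fun_prop)
  have h2 : ∀ᵐ ω ∂P, ∀ p l, Tendsto (sampleMean fun i => S p i ω l ^ 2) atTop
      (𝓝 (∫ ω, Y p ω l ^ 2 ∂P)) := ae_all_iff.2 fun p => ae_all_iff.2 fun l =>
    ae_tendsto_sampleMean (X := fun i ω => S p i ω l ^ 2) (memLp_apply (hL2 p) l).integrable_sq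
      (fun i => (hident p i).comp (u := fun y : EuclideanSpace ℝ (Fin q) => y l ^ 2) (by fun_prop))
      ((hSi p).comp (fun _ y => y l ^ 2) fun _ => by fun_prop)
  filter_upwards [h1, h2] with ω h1 h2
  refine eventually_all.2 fun l => ?_
  have hpos := limitCovariance_diag_pos hcov hβ l
  refine eventually_lt_coordBound hα hβ hn hratio (fun p j => S p j ω) l (fun p => h1 p l)
    (fun p => h2 p l) ?_ hpos (by positivity) ?_
  · rw [limitCovariance_apply]
    refine Finset.sum_congr rfl fun p _ => ?_
    have hl := memLp_apply (hL2 p) l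
    rw [covarianceMatrix, Matrix.of_apply, covariance_self hl.aemeasurable, variance_eq_sub hl]
    rfl
  · rw [mul_pow, Real.sq_sqrt hpos.le]
    gcongr

end Coverage

end EmpLik

theorem mainTheorem7 {Ω : Type*} [MeasurableSpace Ω] (P : Measure Ω) [IsProbabilityMeasure P]
    (m q : ℕ) (α : ℝ) (hα : α ∈ Set.Ioo (0 : ℝ) 1)
    -- the generic random vectors `Y p`, with finite second moments and positive definite covariance
    (Y : Fin m → Ω → EuclideanSpace ℝ (Fin q))
    (hL2 : ∀ p, MemLp (Y p) 2 P)
    (hcov : ∀ p, (EmpLik.covarianceMatrix P (Y p)).PosDef)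
    -- the observations: `S p 0, S p 1, …` are i.i.d. samples of `Y p`, independent across `p`
    (S : Fin m → ℕ → Ω → EuclideanSpace ℝ (Fin q))
    (hident : ∀ p j, IdentDistrib (S p j) (Y p) P P)
    (hindep : iIndepFun (fun pj : Fin m × ℕ => S pj.1 pj.2) P)
    -- the sample sizes: a sequence of size vectors `(n_p)` along which `n → ∞` and `n_p / n → β_p`
    (N : ℕ → Fin m → ℕ) (β : Fin m → ℝ) (hβ : ∀ p, 0 < β p)
    (hn : Tendsto (fun k => EmpLik.avgSize (N k)) atTop atTop)
    (hratio : ∀ p, Tendsto (fun k => (N k p : ℝ) / EmpLik.avgSize (N k)) atTop (𝓝 (β p))) :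
    -- the maxima that define `B` are attained as soon as no sample is empty
    (∀ k ω, (∀ p, 0 < N k p) → ∀ l : Fin q,
      IsGreatest ((fun c : EuclideanSpace ℝ (Fin q) => c l) ''
          EmpLik.confidenceRegion α (N k) (fun p j => S p j ω))
        (EmpLik.coordBound α (N k) (fun p j => S p j ω) l)) ∧
    ENNReal.ofReal (1 - α) ≤
      liminf (fun k => P {ω | ∀ l : Fin q,
        (∑ p, ∫ ω', Y p ω' ∂P) l ≤ EmpLik.coordBound α (N k) (fun p j => S p j ω) l}) atTop := by
  open EmpLik in
  obtain ⟨hα0, hα1⟩ := hα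
  refine ⟨fun k ω hk l => isGreatest_coordBound hα1 hk _ l, ?_⟩
  -- For `q = 0` the event is the whole space; this case is separate because positivity of the
  -- quantile needs `q ≥ 1`.
  rcases isEmpty_or_nonempty (Fin q) with hq | hq
  · simp [hα0.le]
  -- For `m = 0` the average size is identically `0`, contradicting `n → ∞`.
  rcases isEmpty_or_nonempty (Fin m) with hm | hm
  · have h0 : ∀ k, avgSize (N k) = 0 := fun k => by simp [avgSize]
    obtain ⟨k, hk⟩ := (hn.eventually_gt_atTop 0).exists
    exact absurd (h0 k) hk.ne'
  set r := chiSqQuantile q (1 - α)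
  have hrpos : 0 < r := chiSqQuantile_pos (by linarith) (by linarith)
  have hVdiag := limitCovariance_diag_pos hcov hβ
  have hmass : ENNReal.ofReal (1 - α) ≤ chiSqLaw q (Set.Iic r) := by
    rw [← ofReal_measureReal]
    exact ENNReal.ofReal_le_ofReal (le_chiSqLaw_Iic_chiSqQuantile q (by linarith))
  refine hmass.trans ((chiSqLaw_Iic_le_multivariateGaussian
    (posSemidef_limitCovariance hcov hβ) hVdiag r).trans ?_)
  refine measure_orthant_le (fun l => Real.sqrt_nonneg _) (Real.sqrt_pos.2 hrpos)
    fun s hs0 hs => ?_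
  refine (le_liminf_measure_scaledDeviation_mem hL2 hcov hident hindep hβ hn hratio
    (isOpen_orthant _)).trans ?_
  refine liminf_measure_le_of_ae_eventually (fun k => ?_)
    (E := fun k => {ω | 0 < avgSize (N k) ∧ ∀ l,
      ∑ p, sampleMean (fun i => S p i ω l) (N k p) +
        s * √(limitCovariance P Y β l l) / √(avgSize (N k)) <
          coordBound α (N k) (fun p j => S p j ω) l}) ?_ fun k ω => ?_
  · exact (aemeasurable_scaledDeviation (fun p j => (hident p j).aemeasurable_fst)
      (N k)).nullMeasurable (isOpen_orthant _).measurableSet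
  · filter_upwards [ae_eventually_lt_coordBound hα1 hL2 hcov hident hindep hβ hn hratio hs0.le
      ((Real.lt_sqrt hs0.le).1 hs)] with ω hω
    exact (hn.eventually_gt_atTop 0).and hω
  -- The target exceeds the sum of sample means by less than `s √V_ll / √n`, and `B_l` exceeds it by
  -- more.
  · rintro ⟨hD, hn0, hE⟩ l
    have hsq : 0 < √(avgSize (N k)) := Real.sqrt_pos.2 hn0
    have hD' := hD l
    rw [scaledDeviation_apply] at hD'
    have h1 : (∑ p, ∫ ω', Y p ω' ∂P) l - ∑ p, sampleMean (fun i => S p i ω l) (N k p) <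
        s * √(limitCovariance P Y β l l) / √(avgSize (N k)) := by
      rw [lt_div_iff₀ hsq]
      linarith
    linarith [hE l]
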